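/- Let $m\ge 1$ and let $\mathbb N$ be a fixed directed graph on the agents $1,\dots,m$ with a self-arc at every vertex; an arc from $j$ to $i$ means that $j$ is a neighbor of $i$, and $\mathcal N_i$ denotes the set of the $m_i$ neighbors of $i$ (so $i\in\mathcal N_i$). Let $A\in\mathbb R^{n\times n}$, $C_i\in\mathbb R^{s_i\times n}$, and consider the system $\dot x=Ax$, $y_i=C_ix$, $i=1,\dots,m$, on $t\ge 0$. Let $P_i$ be the orthogonal projection of $\mathbb R^n$ onto the unobservable space $\bigcap_{k=0}^{n-1}\ker (C_iA^k)$ of $(C_i,A)$. Suppose that $\mathbb N$ is strongly connected and that the system is jointly observable, i.e. the pair $(C,A)$ is observable, where $C$ is obtained by stacking $C_1,\dots,C_m$. Then for every $\lambda>0$ there are matrices $K_i\in\mathbb R^{n\times s_i}$, $i=1,\dots,m$, and a number $g^*$ such that for every $g\ge g^*$ all estimation errors of the distributed estimator $$\dot x_i=(A+K_iC_i)x_i-K_iy_i-gP_i\Big(x_i-\frac1{m_i}\sum_{j\in\mathcal N_i}x_j\Big),\qquad i=1,\dots,m,$$ converge to zero as fast as $e^{-\lambda t}$ does, whatever the initial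 states: there is a constant $c$ (depending on $g$ but not on the trajectories) such that, for every solution $x,x_1,\dots,x_m$ on $[0,\infty)$, $$\|x_i(t)-x(t)\|\le c\,e^{-\lambda t}\sum_{j=1}^m\|x_j(0)-x(0)\|\qquad\text{for all } t\ge 0 \text{ and } i=1,\dots,m.$$ -/

import Mathlib

/-- The observability matrix of the pair `(C, A)`: the blocks `C, C A, …, C A ^ (n - 1)`
stacked on top of each other. -/
def observabilityMatrix {n : ℕ} {p : Type*} (C : Matrix p (Fin n) ℝ)
    (A : Matrix (Fin n) (Fin n) ℝ) : Matrix (Fin n × p) (Fin n) ℝ :=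
  Matrix.of fun r j => (C * A ^ (r.1 : ℕ)) r.2 j

/-- The unobservable space of the pair `(C, A)`: the kernel of its observability matrix. -/
noncomputable def unobservableSpace {n : ℕ} {p : Type*} [Fintype p] [DecidableEq p]
    (C : Matrix p (Fin n) ℝ) (A : Matrix (Fin n) (Fin n) ℝ) :
    Submodule ℝ (EuclideanSpace ℝ (Fin n)) :=
  LinearMap.ker (Matrix.toEuclideanLin (observabilityMatrix C A))

/-- The pair `(C, A)` is observable: no nonzero state is unobservable, that is, the observability
matrix has full column rank. -/
def IsObservable {n : ℕ} {p : Type*} [Fintype p] [DecidableEq p]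
    (C : Matrix p (Fin n) ℝ) (A : Matrix (Fin n) (Fin n) ℝ) : Prop :=
  unobservableSpace C A = ⊥

/-- The matrix obtained by stacking `C₁, …, C_m` on top of each other. -/
def stackedOutput {m n : ℕ} {s : Fin m → ℕ} (C : ∀ i, Matrix (Fin (s i)) (Fin n) ℝ) :
    Matrix ((i : Fin m) × Fin (s i)) (Fin n) ℝ :=
  Matrix.of fun r j => C r.1 r.2 j

/-- Joint observability: the pair formed by the stacked output matrix and `A` is observable. -/
def IsJointlyObservable {m n : ℕ} {s : Fin m → ℕ} (A : Matrix (Fin n) (Fin n) ℝ)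
    (C : ∀ i, Matrix (Fin (s i)) (Fin n) ℝ) : Prop :=
  IsObservable (stackedOutput C) A

/-- A neighbor graph on `m` agents: a directed graph with a self-arc at each vertex.
An arc from `j` to `i` means that agent `j` is a neighbor of agent `i`. -/
structure NeighborGraph (m : ℕ) extends Digraph (Fin m) where
  self_arc : ∀ i, Adj i i

/-- The set of labels of the neighbors of agent `i`. -/
noncomputable def NeighborGraph.neighbors {m : ℕ} (N : NeighborGraph m) (i : Fin m) :
    Finset (Fin m) := by
  classical exact Finset.univ.filter fun j => N.Adj j i

/-- Strong connectivity: there is a directed path from every vertex to every other vertex. -/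
def NeighborGraph.IsStronglyConnected {m : ℕ} (N : NeighborGraph m) : Prop :=
  ∀ i j, Relation.ReflTransGen N.Adj i j

/-- `x` and `y` are a state trajectory and the sensed signals, for times `t ≥ 0`,
of the system `ẋ = A x`, `y_i = C_i x`. -/
structure IsSystemTrajectory {m n : ℕ} {s : Fin m → ℕ} (A : Matrix (Fin n) (Fin n) ℝ)
    (C : ∀ i, Matrix (Fin (s i)) (Fin n) ℝ) (x : ℝ → EuclideanSpace ℝ (Fin n))
    (y : ∀ i, ℝ → EuclideanSpace ℝ (Fin (s i))) : Prop where
  state : ∀ t, 0 ≤ t → HasDerivWithinAt x (Matrix.toEuclideanLin A (x t)) (Set.Ici 0) t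
  output : ∀ i t, 0 ≤ t → y i t = Matrix.toEuclideanLin (C i) (x t)

/-- The right-hand side of agent `i`'s estimator,
`(A + K_i C_i) z_i - K_i y_i - g P_i (z_i - (1 / m_i) ∑_{j ∈ N_i} z_j)`, where `P_i` is the
orthogonal projection onto the unobservable space of `(C_i, A)`, `z` lists the current estimates
and `w` is the current value of `y_i`. -/
noncomputable def estimatorField {m n : ℕ} {s : Fin m → ℕ} (A : Matrix (Fin n) (Fin n) ℝ)
    (C : ∀ i, Matrix (Fin (s i)) (Fin n) ℝ) (N : NeighborGraph m)
    (K : ∀ i, Matrix (Fin n) (Fin (s i)) ℝ) (g : ℝ) (i : Fin m)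
    (z : Fin m → EuclideanSpace ℝ (Fin n)) (w : EuclideanSpace ℝ (Fin (s i))) :
    EuclideanSpace ℝ (Fin n) :=
  Matrix.toEuclideanLin (A + K i * C i) (z i) - Matrix.toEuclideanLin (K i) w
    - g • (unobservableSpace (C i) A).starProjection
        (z i - (1 / ((N.neighbors i).card : ℝ)) • ∑ j ∈ N.neighbors i, z j)

/-- `xhat 1, …, xhat m` are trajectories, for times `t ≥ 0`, of the distributed estimator driven
by the sensed signals `y_1, …, y_m`. -/
def IsEstimatorTrajectory {m n : ℕ} {s : Fin m → ℕ} (A : Matrix (Fin n) (Fin n) ℝ)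
    (C : ∀ i, Matrix (Fin (s i)) (Fin n) ℝ) (N : NeighborGraph m)
    (K : ∀ i, Matrix (Fin n) (Fin (s i)) ℝ) (g : ℝ)
    (y : ∀ i, ℝ → EuclideanSpace ℝ (Fin (s i)))
    (xhat : Fin m → ℝ → EuclideanSpace ℝ (Fin n)) : Prop :=
  ∀ i t, 0 ≤ t → HasDerivWithinAt (xhat i)
    (estimatorField A C N K g i (fun j => xhat j t) (y i t)) (Set.Ici 0) t

/-! With `e_i = x_i - x` and `S` the averaging matrix, the errors obey `e_i' = (A + K_i C_i) e_i - g
P_i (e_i - ∑ S_ij e_j)`. The Lyapunov function is `Y + M Q`, where `Q` measures the errors modulo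
the unobservable spaces `U_i` and `Y` measures their components in `U_i`.

`Q = ∑ ⟪W_i e_i, e_i⟫`, with `W_i` a Gramian discounted at rate `lam + 1` whose kernel is `U_i`. A
gain with `W_i K_i = -C_iᵀ` makes `Q` decay at rate `2 (lam + 1)`; the coupling takes values in
`U_i`, so `Q` does not see it (`exists_observer_gain`).

`Y = ∑ π_i ‖P_i e_i‖²`, with `π > 0` a left fixed vector of `S`. For `e_i ∈ U_i` the coupling
dissipates `g ∑ π_i S_ij ‖e_i - e_j‖²`. This vanishes only if all `e_i` agree; the common value then
lies in every `U_i`, hence is `0`. So a large `g` forces rate `2 lam` on the product of the `U_i`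
(`exists_coupling_gain`).

Off that product `Q > 0`, and a large `M`, depending on `g`, absorbs the cross terms. Finsler's
lemma supplies both `g` and `M`. -/

open scoped InnerProductSpace

/-! ### Finsler's lemma and scalar decay -/

/-- Finsler's lemma for functions that are homogeneous of degree two, relative to a subspace. -/
theorem exists_forall_add_mul_pos_of_homogeneous {E : Type*} [NormedAddCommGroup E]
    [NormedSpace ℝ E] [FiniteDimensional ℝ E] (S : Submodule ℝ E) {f h : E → ℝ}
    (hf : Continuous f) (hh : Continuous h)
    (hf2 : ∀ (r : ℝ) x, f (r • x) = r ^ 2 * f x) (hh2 : ∀ (r : ℝ) x, h (r • x) = r ^ 2 * h x)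
    (hnonneg : ∀ x ∈ S, 0 ≤ h x) (hpos : ∀ x ∈ S, x ≠ 0 → h x = 0 → 0 < f x) :
    ∃ M₀ : ℝ, ∀ M, M₀ ≤ M → ∀ x ∈ S, x ≠ 0 → 0 < f x + M * h x := by
  have : ProperSpace E := FiniteDimensional.proper ℝ E
  have hScl : IsClosed (S : Set E) := S.closed_of_finiteDimensional
  have hK : IsCompact (Metric.sphere (0 : E) 1 ∩ S) := (isCompact_sphere _ _).inter_right hScl
  have hZ : IsCompact ((Metric.sphere (0 : E) 1 ∩ S) ∩ {x | f x ≤ 0}) :=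
    hK.inter_right (isClosed_le hf continuous_const)
  obtain ⟨M₀, hM₀⟩ : ∃ M₀ : ℝ, ∀ M, M₀ ≤ M → ∀ x ∈ Metric.sphere (0 : E) 1 ∩ S,
      0 < f x + M * h x := by
    rcases ((Metric.sphere (0 : E) 1 ∩ S) ∩ {x | f x ≤ 0}).eq_empty_or_nonempty with he | hne
    · refine ⟨0, fun M hM x hx => ?_⟩
      have : 0 < f x := by
        by_contra! hc
        exact (he ▸ (⟨hx, hc⟩ : x ∈ (Metric.sphere (0 : E) 1 ∩ S) ∩ {x | f x ≤ 0}) :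
          x ∈ (∅ : Set E))
      have := mul_nonneg hM (hnonneg x hx.2)
      linarith
    · obtain ⟨a, ha, hamin⟩ := hZ.exists_isMinOn hne hh.continuousOn
      obtain ⟨b, hb, hbmin⟩ := hZ.exists_isMinOn hne hf.continuousOn
      have hane : a ≠ 0 := by
        rintro rfl
        simpa using ha.1.1
      have hha : 0 < h a := by
        rcases (hnonneg a ha.1.2).lt_or_eq with hlt | heq
        · exact hlt
        · exact absurd (hpos a ha.1.2 hane heq.symm) (not_lt.2 ha.2)
      -- On the part of the sphere in `S` where `f ≤ 0`, compactness gives `f ≥ f b` and `h ≥ h a >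
      -- 0`, so this threshold makes the sum at least `1` there.
      refine ⟨max 0 ((-f b + 1) / h a), fun M hM x hx => ?_⟩
      have hM0 : 0 ≤ M := (le_max_left _ _).trans hM
      have hM1 : -f b + 1 ≤ M * h a := (div_le_iff₀ hha).1 ((le_max_right _ _).trans hM)
      rcases lt_or_ge 0 (f x) with hfx | hfx
      · have := mul_nonneg hM0 (hnonneg x hx.2)
        linarith
      · have h1 : h a ≤ h x := hamin ⟨hx, hfx⟩
        have h2 : f b ≤ f x := hbmin ⟨hx, hfx⟩
        have := mul_le_mul_of_nonneg_left h1 hM0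
        linarith
  refine ⟨M₀, fun M hM x hx hx0 => ?_⟩
  have hn : 0 < ‖x‖ := norm_pos_iff.2 hx0
  have := hM₀ M hM (‖x‖⁻¹ • x)
    ⟨by simp [norm_smul, hn.ne'], S.smul_mem _ hx⟩
  rw [hf2, hh2] at this
  have h3 : 0 < ‖x‖⁻¹ ^ 2 * (f x + M * h x) := by linarith
  exact pos_of_mul_pos_right h3 (by positivity)

/-- A function on `[0, ∞)` that satisfies `φ' ≤ -a φ` decays at least as fast as `e ^ (-a t)`. -/
theorem le_exp_mul_of_hasDerivWithinAt_le {φ φ' : ℝ → ℝ} {a : ℝ}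
    (hφ : ∀ t, 0 ≤ t → HasDerivWithinAt φ (φ' t) (Set.Ici 0) t)
    (hle : ∀ t, 0 ≤ t → φ' t ≤ -a * φ t) {t : ℝ} (ht : 0 ≤ t) :
    φ t ≤ Real.exp (-a * t) * φ 0 := by
  have hd : ∀ t, 0 ≤ t → HasDerivWithinAt (fun t => Real.exp (a * t) * φ t)
      (Real.exp (a * t) * a * φ t + Real.exp (a * t) * φ' t) (Set.Ici 0) t := by
    intro t ht
    have h1 : HasDerivAt (fun t => Real.exp (a * t)) (Real.exp (a * t) * a) t := by
      simpa using ((hasDerivAt_id t).const_mul a).exp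
    exact h1.hasDerivWithinAt.mul (hφ t ht)
  have hanti : AntitoneOn (fun t => Real.exp (a * t) * φ t) (Set.Ici 0) := by
    refine antitoneOn_of_hasDerivWithinAt_nonpos (convex_Ici 0)
      (fun t ht => (hd t ht).continuousWithinAt)
      (fun t ht => (hd t (interior_subset ht)).mono interior_subset) fun t ht => ?_
    have := mul_le_mul_of_nonneg_left (hle t (interior_subset ht)) (Real.exp_pos (a * t)).le
    linarith
  have h0 := hanti (Set.mem_Ici.2 le_rfl) (Set.mem_Ici.2 ht) ht
  simp only [mul_zero, Real.exp_zero, one_mul] at h0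
  have h2 : Real.exp (-a * t) * (Real.exp (a * t) * φ t) = φ t := by
    rw [← mul_assoc, ← Real.exp_add]; simp
  rw [← h2]
  exact mul_le_mul_of_nonneg_left h0 (Real.exp_pos _).le

/-! ### Discounted Gramian and the gain equation -/

section Gramian

variable {E F : Type*} [NormedAddCommGroup E] [InnerProductSpace ℝ E] [FiniteDimensional ℝ E]
  [NormedAddCommGroup F] [InnerProductSpace ℝ F]

theorem hasDerivAt_output_exp (A : E →L[ℝ] E) (C : E →L[ℝ] F) (x : E) (t : ℝ) :
    HasDerivAt (fun t : ℝ => C (NormedSpace.exp (t • -A) x))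
      (-C (NormedSpace.exp (t • -A) (A x))) t := by
  have : CompleteSpace E := FiniteDimensional.complete ℝ E
  have h := (hasDerivAt_exp_smul_const (𝕂 := ℝ) (-A) t)
  have h2 := h.clm_apply (hasDerivAt_const t x)
  have h3 := C.hasFDerivAt.comp_hasDerivAt t h2
  simpa [Function.comp_def] using h3

/-- Every term of the exponential series, applied to `x` and then to `C`, is a multiple of some `C
(A ^ k x)`. -/
theorem output_exp_eq_zero {A : E →L[ℝ] E} {C : E →L[ℝ] F} {x : E}
    (hx : ∀ k : ℕ, C ((A ^ k) x) = 0) (t : ℝ) : C (NormedSpace.exp (t • -A) x) = 0 := by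
  have : CompleteSpace E := FiniteDimensional.complete ℝ E
  have h := NormedSpace.exp_series_hasSum_exp' (𝕂 := ℝ) (t • -A)
  have h2 := (h.mapL (ContinuousLinearMap.apply ℝ E x)).mapL C
  refine h2.unique ?_
  convert hasSum_zero with k
  have hk : (t • -A) ^ k = (-t) ^ k • A ^ k := by
    rw [smul_neg, ← neg_smul, smul_pow]
  rw [hk, map_smul, map_smul, map_smul, map_smul, ContinuousLinearMap.apply_apply, hx k, smul_zero,
    smul_zero]

variable [FiniteDimensional ℝ F]

/-- A discounted observability Gramian of the pair `(C, A)`. -/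
theorem exists_discounted_gramian (A : E →L[ℝ] E) (C : E →L[ℝ] F) (κ : ℝ) :
    ∃ W : E →L[ℝ] E, (∀ x y, ⟪W x, y⟫_ℝ = ⟪x, W y⟫_ℝ) ∧ (∀ x, 0 ≤ ⟪W x, x⟫_ℝ) ∧
      (∀ x, ⟪W x, x⟫_ℝ = 0 → ∀ k : ℕ, C ((A ^ k) x) = 0) ∧
      (∀ x, (∀ k : ℕ, C ((A ^ k) x) = 0) → W x = 0) ∧
      ∀ x, 2 * ⟪W x, A x⟫_ℝ + 2 * κ * ⟪W x, x⟫_ℝ ≤ ‖C x‖ ^ 2 := by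
  have : CompleteSpace E := FiniteDimensional.complete ℝ E
  have : CompleteSpace F := FiniteDimensional.complete ℝ F
  set Φ : ℝ → E →L[ℝ] E := fun t => NormedSpace.exp (t • -A) with hΦ
  have hΦc : Continuous Φ := continuous_iff_continuousAt.2 fun t =>
    (hasDerivAt_exp_smul_const (𝕂 := ℝ) (-A) t).continuousAt
  have hd : ∀ x t, HasDerivAt (fun t => C (Φ t x)) (-C (Φ t (A x))) t :=
    hasDerivAt_output_exp A C
  have hΦ0 : ∀ x, Φ 0 x = x := fun x => by simp [hΦ]
  -- The horizon is finite and time runs backwards, so no stability of `A` is needed for the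
  -- integral.
  set G : ℝ → E →L[ℝ] E := fun t => Real.exp (-(2 * κ) * t) •
    (ContinuousLinearMap.adjoint (C ∘L Φ t) ∘L (C ∘L Φ t)) with hG
  have hCΦ : Continuous fun t => C ∘L Φ t := by fun_prop
  have hGc : Continuous G := by
    have : Continuous fun t => ContinuousLinearMap.adjoint (C ∘L Φ t) :=
      ContinuousLinearMap.adjoint.continuous.comp hCΦ
    fun_prop
  have hGi : ∀ t x y, ⟪G t x, y⟫_ℝ = Real.exp (-(2 * κ) * t) * ⟪C (Φ t x), C (Φ t y)⟫_ℝ := by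
    intro t x y
    simp only [hG, _root_.smul_apply, ContinuousLinearMap.comp_apply,
      real_inner_smul_left, ContinuousLinearMap.adjoint_inner_left]
  set W : E →L[ℝ] E := ∫ t in (0 : ℝ)..1, G t with hW
  have hWx : ∀ x, W x = ∫ t in (0 : ℝ)..1, G t x := fun x =>
    ((ContinuousLinearMap.apply ℝ E x).intervalIntegral_comp_comm
      (hGc.intervalIntegrable 0 1)).symm
  have hWi : ∀ x y, ⟪W x, y⟫_ℝ =
      ∫ t in (0 : ℝ)..1, Real.exp (-(2 * κ) * t) * ⟪C (Φ t x), C (Φ t y)⟫_ℝ := by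
    intro x y
    have hc : Continuous fun t => G t x := by fun_prop
    have := (innerSL ℝ y).intervalIntegral_comp_comm (μ := MeasureTheory.volume)
      (hc.intervalIntegrable 0 1)
    rw [hWx, real_inner_comm, ← innerSL_apply_apply ℝ y, ← this]
    refine intervalIntegral.integral_congr fun t _ => ?_
    simp only [innerSL_apply_apply]
    rw [real_inner_comm, hGi]
  have hcx : ∀ x, Continuous fun t => C (Φ t x) := fun x => by fun_prop
  refine ⟨W, ?_, ?_, ?_, ?_, ?_⟩
  · intro x y
    rw [real_inner_comm (W y) x, hWi, hWi]
    refine intervalIntegral.integral_congr fun t _ => ?_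
    simp only [real_inner_comm (C (Φ t x)) (C (Φ t y))]
  · intro x
    rw [hWi]
    refine intervalIntegral.integral_nonneg zero_le_one fun t _ => ?_
    exact mul_nonneg (Real.exp_pos _).le real_inner_self_nonneg
  · intro x hx
    have h0 : ∀ t ∈ Set.Ioo (0 : ℝ) 1, C (Φ t x) = 0 := by
      by_contra! hne
      obtain ⟨t, ht, htne⟩ := hne
      have hpos : 0 < ⟪W x, x⟫_ℝ := by
        rw [hWi]
        refine intervalIntegral.integral_pos zero_lt_one ?_ ?_ ⟨t, Set.Ioo_subset_Icc_self ht, ?_⟩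
        · have := hcx x
          exact Continuous.continuousOn (by fun_prop)
        · exact fun t _ => mul_nonneg (Real.exp_pos _).le real_inner_self_nonneg
        · exact mul_pos (Real.exp_pos _) (real_inner_self_pos.2 htne)
      exact hpos.ne' hx
    -- Differentiating the vanishing output replaces `x` by `-A x`. The interval is open so that
    -- this can be iterated; continuity then gives `t = 0`.
    have hk : ∀ k : ℕ, ∀ t ∈ Set.Ioo (0 : ℝ) 1, C (Φ t ((A ^ k) x)) = 0 := by
      intro k
      induction k with
      | zero => simpa using h0
      | succ k ih =>
        intro t ht
        have he : (fun t => C (Φ t ((A ^ k) x))) =ᶠ[nhds t] fun _ => 0 := by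
          filter_upwards [isOpen_Ioo.mem_nhds ht] with s hs using ih s hs
        have h1 := (hd ((A ^ k) x) t).unique ((hasDerivAt_const t (0 : F)).congr_of_eventuallyEq he)
        rw [neg_eq_zero] at h1
        rw [pow_succ']
        exact h1
    intro k
    have hcl : Set.EqOn (fun t => C (Φ t ((A ^ k) x))) (fun _ => 0) (closure (Set.Ioo (0 : ℝ) 1)) :=
      Set.EqOn.closure (hk k) (hcx _) continuous_const
    rw [closure_Ioo zero_ne_one] at hcl
    simpa [hΦ0] using hcl (Set.left_mem_Icc.2 zero_le_one)
  · intro x hx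
    refine ext_inner_right ℝ fun y => ?_
    have h0 : ∀ t, C (Φ t x) = 0 := output_exp_eq_zero hx
    simp [hWi, h0]
  · intro x
    -- Minus the discounted output energy is a primitive of the integrand of the left side, which
    -- therefore equals `‖C x‖²` minus a nonnegative term at time `1`.
    have hD : ∀ t, HasDerivAt (fun t => -(Real.exp (-(2 * κ) * t) * ⟪C (Φ t x), C (Φ t x)⟫_ℝ))
        (2 * (Real.exp (-(2 * κ) * t) * ⟪C (Φ t x), C (Φ t (A x))⟫_ℝ) +
          2 * κ * (Real.exp (-(2 * κ) * t) * ⟪C (Φ t x), C (Φ t x)⟫_ℝ)) t := by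
      intro t
      have h1 : HasDerivAt (fun t => Real.exp (-(2 * κ) * t))
          (Real.exp (-(2 * κ) * t) * -(2 * κ)) t := by
        simpa using ((hasDerivAt_id t).const_mul (-(2 * κ))).exp
      have h2 := (h1.mul ((hd x t).inner ℝ (hd x t))).neg
      refine h2.congr_deriv ?_
      rw [inner_neg_left, inner_neg_right, real_inner_comm (C (Φ t x)) (C (Φ t (A x)))]
      ring
    have hc1 : Continuous fun t => Real.exp (-(2 * κ) * t) * ⟪C (Φ t x), C (Φ t (A x))⟫_ℝ := by
      have := hcx x
      have := hcx (A x)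
      fun_prop
    have hc2 : Continuous fun t => Real.exp (-(2 * κ) * t) * ⟪C (Φ t x), C (Φ t x)⟫_ℝ := by
      have := hcx x
      fun_prop
    have hftc := intervalIntegral.integral_eq_sub_of_hasDerivAt (a := 0) (b := 1)
      (fun t _ => hD t) (Continuous.intervalIntegrable (by fun_prop) _ _)
    rw [intervalIntegral.integral_add ((hc1.const_mul 2).intervalIntegrable _ _)
      ((hc2.const_mul (2 * κ)).intervalIntegrable _ _), intervalIntegral.integral_const_mul,
      intervalIntegral.integral_const_mul, ← hWi, ← hWi] at hftc
    rw [hftc]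
    have : 0 ≤ Real.exp (-(2 * κ) * 1) * ⟪C (Φ 1 x), C (Φ 1 x)⟫_ℝ :=
      mul_nonneg (Real.exp_pos _).le real_inner_self_nonneg
    rw [hΦ0, real_inner_self_eq_norm_sq (C x)]
    simp only [mul_zero, Real.exp_zero, one_mul]
    linarith

/-- If the kernel of the symmetric operator `W` lies in the kernel of `C`, then `W K = -C†` has a
solution `K`. -/
theorem exists_gain_of_ker_le {W : E →L[ℝ] E} {C : E →L[ℝ] F}
    (hsymm : ∀ x y, ⟪W x, y⟫_ℝ = ⟪x, W y⟫_ℝ) (hker : ∀ x, W x = 0 → C x = 0) :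
    ∃ K : F →ₗ[ℝ] E, ∀ x w, ⟪W x, K w⟫_ℝ = -⟪C x, w⟫_ℝ := by
  have : CompleteSpace E := FiniteDimensional.complete ℝ E
  have : CompleteSpace F := FiniteDimensional.complete ℝ F
  have hWs : (W : E →ₗ[ℝ] E).IsSymmetric := hsymm
  have hrange : ∀ w, -ContinuousLinearMap.adjoint C w ∈ LinearMap.range (W : E →ₗ[ℝ] E) := by
    intro w
    -- The range of a symmetric operator is the orthogonal complement of its kernel.
    rw [← (LinearMap.range (W : E →ₗ[ℝ] E)).orthogonal_orthogonal, hWs.orthogonal_range,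
      Submodule.mem_orthogonal]
    intro z hz
    rw [inner_neg_right, ContinuousLinearMap.adjoint_inner_right, hker z hz, inner_zero_left,
      neg_zero]
  -- Projectivity of `F` selects the solutions of `W (K w) = -C† w` linearly in `w`.
  obtain ⟨K, hK⟩ := Module.projective_lifting_property (W : E →ₗ[ℝ] E).rangeRestrict
    (LinearMap.codRestrict _ (-(ContinuousLinearMap.adjoint C : F →ₗ[ℝ] E)) hrange)
    (W : E →ₗ[ℝ] E).surjective_rangeRestrict
  refine ⟨K, fun x w => ?_⟩
  have hw : W (K w) = -ContinuousLinearMap.adjoint C w :=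
    congrArg Subtype.val (LinearMap.congr_fun hK w)
  rw [hsymm, hw, inner_neg_right, ContinuousLinearMap.adjoint_inner_right]

end Gramian

/-! ### Unobservable spaces and local observers -/

theorem toEuclideanLin_mul_pow_apply {n : ℕ} {p : Type*} [Fintype p] [DecidableEq p]
    (C : Matrix p (Fin n) ℝ) (A : Matrix (Fin n) (Fin n) ℝ) (k : ℕ)
    (x : EuclideanSpace ℝ (Fin n)) :
    Matrix.toEuclideanLin (C * A ^ k) x =
      Matrix.toEuclideanLin C ((Matrix.toEuclideanLin A ^ k) x) := by
  simp only [Matrix.toEuclideanLin, Matrix.toLpLin_mul_same, Matrix.toLpLin_pow]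
  rfl

/-- Cayley–Hamilton: `A ^ k` is the value at `A` of the remainder of `X ^ k` modulo the
characteristic polynomial, of degree below `n`. The case `n = 0` is separate because that polynomial
is then `1`. -/
theorem toEuclideanLin_pow_apply_eq_zero {n : ℕ} {p : Type*} [Fintype p] [DecidableEq p]
    {C : Matrix p (Fin n) ℝ} {A : Matrix (Fin n) (Fin n) ℝ} {x : EuclideanSpace ℝ (Fin n)}
    (h : ∀ k < n, Matrix.toEuclideanLin (C * A ^ k) x = 0) (k : ℕ) :
    Matrix.toEuclideanLin (C * A ^ k) x = 0 := by
  rcases Nat.eq_zero_or_pos n with rfl | hn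
  · have : x = 0 := Subsingleton.elim _ _
    rw [this, map_zero]
  rw [Matrix.pow_eq_aeval_mod_charpoly A k, Polynomial.aeval_eq_sum_range, Matrix.mul_sum, map_sum,
    LinearMap.sum_apply]
  refine Finset.sum_eq_zero fun l hl => ?_
  have hdeg : (Polynomial.X ^ k %ₘ A.charpoly).natDegree < n := by
    have := Polynomial.natDegree_modByMonic_lt (Polynomial.X ^ k) A.charpoly_monic (by
      intro h1
      have := A.charpoly_natDegree_eq_dim
      simp [h1] at this
      omega)
    simpa using this
  rw [Matrix.mul_smul, map_smul, LinearMap.smul_apply, h l (by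
    have := Finset.mem_range.1 hl
    omega), smul_zero]

theorem mem_unobservableSpace_iff {n : ℕ} {p : Type*} [Fintype p] [DecidableEq p]
    (C : Matrix p (Fin n) ℝ) (A : Matrix (Fin n) (Fin n) ℝ) (x : EuclideanSpace ℝ (Fin n)) :
    x ∈ unobservableSpace C A ↔
      ∀ k : ℕ, Matrix.toEuclideanLin C ((Matrix.toEuclideanLin A ^ k) x) = 0 := by
  have key : x ∈ unobservableSpace C A ↔ ∀ k < n, Matrix.toEuclideanLin (C * A ^ k) x = 0 := by
    rw [unobservableSpace, LinearMap.mem_ker]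
    constructor
    · intro h k hk
      ext q
      exact congrFun (congrArg WithLp.ofLp h) (⟨k, hk⟩, q)
    · intro h
      ext ⟨k, q⟩
      exact congrFun (congrArg WithLp.ofLp (h k k.2)) q
  rw [key]
  simp only [← toEuclideanLin_mul_pow_apply]
  exact ⟨toEuclideanLin_pow_apply_eq_zero, fun h k _ => h k⟩

/-- Each row of the stacked output belongs to one agent, so a state invisible to every agent is
invisible to the stack. -/
theorem IsJointlyObservable.eq_zero_of_forall_mem {m n : ℕ} {s : Fin m → ℕ}
    {A : Matrix (Fin n) (Fin n) ℝ} {C : ∀ i, Matrix (Fin (s i)) (Fin n) ℝ}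
    (h : IsJointlyObservable A C) {x : EuclideanSpace ℝ (Fin n)}
    (hx : ∀ i, x ∈ unobservableSpace (C i) A) : x = 0 := by
  rw [← Submodule.mem_bot ℝ, ← show unobservableSpace (stackedOutput C) A = ⊥ from h,
    mem_unobservableSpace_iff]
  intro k
  ext ⟨i, q⟩
  exact congrFun (congrArg WithLp.ofLp ((mem_unobservableSpace_iff _ _ _).1 (hx i) k)) q

/-- A local observer gain together with a quadratic form that certifies the decay rate `κ` of the
local error transversally to the unobservable space. -/
theorem exists_observer_gain {n p : ℕ} (A : Matrix (Fin n) (Fin n) ℝ)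
    (C : Matrix (Fin p) (Fin n) ℝ) (κ : ℝ) :
    ∃ (K : Matrix (Fin n) (Fin p) ℝ) (W : EuclideanSpace ℝ (Fin n) →L[ℝ] EuclideanSpace ℝ (Fin n)),
      (∀ x y, ⟪W x, y⟫_ℝ = ⟪x, W y⟫_ℝ) ∧ (∀ x, 0 ≤ ⟪W x, x⟫_ℝ) ∧
      (∀ x, ⟪W x, x⟫_ℝ = 0 → x ∈ unobservableSpace C A) ∧
      (∀ x, ∀ v ∈ unobservableSpace C A, ⟪W x, v⟫_ℝ = 0) ∧
      ∀ x, ⟪W x, Matrix.toEuclideanLin (A + K * C) x⟫_ℝ ≤ -κ * ⟪W x, x⟫_ℝ := by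
  obtain ⟨W, hsymm, hnonneg, hker, hzero, hle⟩ := exists_discounted_gramian
    (Matrix.toEuclideanLin A).toContinuousLinearMap (Matrix.toEuclideanLin C).toContinuousLinearMap κ
  have hpow : ∀ (k : ℕ) x, ((Matrix.toEuclideanLin A).toContinuousLinearMap ^ k) x =
      (Matrix.toEuclideanLin A ^ k) x := by
    intro k
    induction k with
    | zero => intro x; rfl
    | succ k ih => intro x; rw [pow_succ, pow_succ]; exact ih _
  have hmem : ∀ x, x ∈ unobservableSpace C A ↔ ∀ k : ℕ,
      (Matrix.toEuclideanLin C).toContinuousLinearMap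
        (((Matrix.toEuclideanLin A).toContinuousLinearMap ^ k) x) = 0 := by
    intro x
    rw [mem_unobservableSpace_iff]
    exact forall_congr' fun k => by rw [hpow]; rfl
  obtain ⟨K, hK⟩ := exists_gain_of_ker_le (W := W)
    (C := (Matrix.toEuclideanLin C).toContinuousLinearMap) hsymm fun x hx => by
      simpa using hker x (by rw [hx, inner_zero_left]) 0
  refine ⟨Matrix.toEuclideanLin.symm K, W, hsymm, hnonneg, fun x hx => (hmem x).2 (hker x hx),
    fun x v hv => ?_, fun x => ?_⟩
  · rw [hsymm, hzero v ((hmem v).1 hv), inner_zero_right]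
  · have hfield : Matrix.toEuclideanLin (A + Matrix.toEuclideanLin.symm K * C) x =
        Matrix.toEuclideanLin A x + K (Matrix.toEuclideanLin C x) := by
      have hmul : Matrix.toEuclideanLin (Matrix.toEuclideanLin.symm K * C) =
          Matrix.toEuclideanLin (Matrix.toEuclideanLin.symm K) ∘ₗ Matrix.toEuclideanLin C :=
        Matrix.toLpLin_mul_same _ _ _
      rw [map_add, LinearMap.add_apply, hmul, LinearEquiv.apply_symm_apply]
      rfl
    have h1 := hle x
    have h2 := hK x (Matrix.toEuclideanLin C x)
    simp only [LinearMap.coe_toContinuousLinearMap'] at h1 h2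
    rw [real_inner_self_eq_norm_sq] at h2
    rw [hfield, inner_add_right, h2]
    -- The gain contributes `-‖C x‖²`, twice what the halved Gramian inequality needs.
    nlinarith [sq_nonneg ‖Matrix.toEuclideanLin C x‖]

/-! ### Stochastic matrices and graph averaging -/

/-- An irreducible stochastic matrix has a positive left fixed vector. -/
theorem exists_pos_left_fixed_of_stochastic {ι : Type*} [Fintype ι] [DecidableEq ι] [Nonempty ι]
    {S : Matrix ι ι ℝ} (hS : ∀ i j, 0 ≤ S i j) (hrow : ∀ i, ∑ j, S i j = 1)
    (hconn : ∀ i j, Relation.ReflTransGen (fun a b => 0 < S b a) i j) :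
    ∃ π : ι → ℝ, (∀ i, 0 < π i) ∧ ∀ j, ∑ i, π i * S i j = π j := by
  have hdet : (1 - S).det = 0 := by
    rw [← Matrix.exists_mulVec_eq_zero_iff]
    refine ⟨fun _ => 1, fun h => one_ne_zero (congrFun h (Classical.arbitrary ι)), ?_⟩
    ext i
    rw [Matrix.sub_mulVec, Matrix.one_mulVec]
    simp [Matrix.mulVec, dotProduct, hrow]
  obtain ⟨w, hw0, hw⟩ := Matrix.exists_vecMul_eq_zero_iff.2 hdet
  have hfix : ∀ j, ∑ i, w i * S i j = w j := by
    intro j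
    have := congrFun hw j
    rw [Matrix.vecMul_sub, Matrix.vecMul_one, Pi.sub_apply, Pi.zero_apply, sub_eq_zero] at this
    exact this.symm
  have hle : ∀ j, |w j| ≤ ∑ i, |w i| * S i j := by
    intro j
    rw [← hfix j]
    refine (Finset.abs_sum_le_sum_abs _ _).trans (le_of_eq ?_)
    exact Finset.sum_congr rfl fun i _ => by rw [abs_mul, abs_of_nonneg (hS i j)]
  -- The entrywise inequalities have equal totals because rows sum to `1`, so each is an equality
  -- and `|w|` is also fixed.
  have hsum : ∑ j, |w j| = ∑ j, ∑ i, |w i| * S i j := by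
    rw [Finset.sum_comm]
    exact Finset.sum_congr rfl fun i _ => by rw [← Finset.mul_sum, hrow, mul_one]
  have heq : ∀ j, |w j| = ∑ i, |w i| * S i j := fun j =>
    (Finset.sum_eq_sum_iff_of_le fun j _ => hle j).1 hsum j (Finset.mem_univ j)
  obtain ⟨i₀, hi₀⟩ := Function.ne_iff.1 hw0
  refine ⟨fun i => |w i|, fun i => ?_, fun j => (heq j).symm⟩
  -- Positivity travels backwards along a path to `i₀`: an arc from `a` to `b` gives `|w a| ≥ |w b|
  -- * S b a`.
  refine Relation.ReflTransGen.head_induction_on (hconn i i₀) (abs_pos.2 hi₀) ?_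
  intro a b hab _ hb
  change 0 < |w a|
  rw [heq a]
  exact Finset.sum_pos' (fun i _ => mul_nonneg (abs_nonneg _) (hS i a))
    ⟨b, Finset.mem_univ b, mul_pos hb hab⟩

/-- The dissipation identity for the Laplacian of a stochastic matrix with left fixed vector `π`. -/
theorem two_mul_sum_inner_sub_average {ι E : Type*} [Fintype ι] [NormedAddCommGroup E]
    [InnerProductSpace ℝ E] {S : Matrix ι ι ℝ} {π : ι → ℝ} (hrow : ∀ i, ∑ j, S i j = 1)
    (hπ : ∀ j, ∑ i, π i * S i j = π j) (e : ι → E) :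
    2 * ∑ i, π i * ⟪e i, e i - ∑ j, S i j • e j⟫_ℝ =
      ∑ i, ∑ j, π i * S i j * ‖e i - e j‖ ^ 2 := by
  have h1 : ∑ i, ∑ j, π i * S i j * ‖e i - e j‖ ^ 2 =
      ∑ i, ∑ j, π i * S i j * ‖e i‖ ^ 2 - 2 * ∑ i, ∑ j, π i * S i j * ⟪e i, e j⟫_ℝ +
        ∑ i, ∑ j, π i * S i j * ‖e j‖ ^ 2 := by
    simp only [Finset.mul_sum, ← Finset.sum_sub_distrib, ← Finset.sum_add_distrib]
    refine Finset.sum_congr rfl fun i _ => Finset.sum_congr rfl fun j _ => ?_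
    rw [norm_sub_sq_real]
    ring
  have h2 : ∑ i, ∑ j, π i * S i j * ‖e i‖ ^ 2 = ∑ i, π i * ‖e i‖ ^ 2 :=
    Finset.sum_congr rfl fun i _ => by
      rw [← Finset.sum_mul, ← Finset.mul_sum, hrow, mul_one]
  have h3 : ∑ i, ∑ j, π i * S i j * ‖e j‖ ^ 2 = ∑ i, π i * ‖e i‖ ^ 2 := by
    rw [Finset.sum_comm]
    exact Finset.sum_congr rfl fun j _ => by rw [← Finset.sum_mul, hπ]
  have h4 : ∑ i, π i * ⟪e i, e i - ∑ j, S i j • e j⟫_ℝ =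
      ∑ i, π i * ‖e i‖ ^ 2 - ∑ i, ∑ j, π i * S i j * ⟪e i, e j⟫_ℝ := by
    rw [← Finset.sum_sub_distrib]
    refine Finset.sum_congr rfl fun i _ => ?_
    rw [inner_sub_right, real_inner_self_eq_norm_sq, inner_sum, mul_sub, Finset.mul_sum]
    congr 1
    exact Finset.sum_congr rfl fun j _ => by rw [real_inner_smul_right]; ring
  rw [h1, h2, h3, h4]
  ring

/-- The row-stochastic averaging matrix of a neighbor graph. -/
noncomputable def NeighborGraph.averaging {m : ℕ} (N : NeighborGraph m) :
    Matrix (Fin m) (Fin m) ℝ := by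
  classical exact Matrix.of fun i j => if N.Adj j i then 1 / ((N.neighbors i).card : ℝ) else 0

namespace NeighborGraph

variable {m : ℕ} (N : NeighborGraph m)

theorem mem_neighbors {i j : Fin m} : j ∈ N.neighbors i ↔ N.Adj j i := by
  classical simp [neighbors]

theorem card_neighbors_pos (i : Fin m) : 0 < ((N.neighbors i).card : ℝ) :=
  Nat.cast_pos.2 (Finset.card_pos.2 ⟨i, N.mem_neighbors.2 (N.self_arc i)⟩)

theorem averaging_nonneg (i j : Fin m) : 0 ≤ N.averaging i j := by
  simp only [averaging, Matrix.of_apply]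
  split_ifs
  · exact (one_div_pos.2 (N.card_neighbors_pos i)).le
  · exact le_rfl

theorem averaging_pos {i j : Fin m} (h : N.Adj j i) : 0 < N.averaging i j := by
  simp only [averaging, Matrix.of_apply, if_pos h]
  exact one_div_pos.2 (N.card_neighbors_pos i)

theorem sum_averaging_smul {E : Type*} [AddCommGroup E] [Module ℝ E] (i : Fin m) (e : Fin m → E) :
    ∑ j, N.averaging i j • e j =
      (1 / ((N.neighbors i).card : ℝ)) • ∑ j ∈ N.neighbors i, e j := by
  classical
  simp only [averaging, Matrix.of_apply, ite_smul, zero_smul, Finset.smul_sum]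
  rw [← Finset.sum_filter]
  refine Finset.sum_congr ?_ fun _ _ => rfl
  ext j
  simp [mem_neighbors]

theorem sum_averaging (i : Fin m) : ∑ j, N.averaging i j = 1 := by
  have := N.sum_averaging_smul i fun _ => (1 : ℝ)
  simpa [(N.card_neighbors_pos i).ne'] using this

end NeighborGraph

/-! ### Error equation, coupling gain and Lyapunov estimate -/

section ErrorDynamics

variable {m n : ℕ} {s : Fin m → ℕ}

/-- The right-hand side of the error equation of agent `i`. -/
noncomputable def errorField (A : Matrix (Fin n) (Fin n) ℝ)
    (C : ∀ i, Matrix (Fin (s i)) (Fin n) ℝ) (N : NeighborGraph m)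
    (K : ∀ i, Matrix (Fin n) (Fin (s i)) ℝ) (g : ℝ) (i : Fin m)
    (e : Fin m → EuclideanSpace ℝ (Fin n)) : EuclideanSpace ℝ (Fin n) :=
  Matrix.toEuclideanLin (A + K i * C i) (e i)
    - g • (unobservableSpace (C i) A).starProjection (e i - ∑ j, N.averaging i j • e j)

/-- The `K i` terms driven by `x` cancel, and unit row sums make the averaging blind to a common
shift by `x`. -/
theorem estimatorField_sub (A : Matrix (Fin n) (Fin n) ℝ)
    (C : ∀ i, Matrix (Fin (s i)) (Fin n) ℝ) (N : NeighborGraph m)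
    (K : ∀ i, Matrix (Fin n) (Fin (s i)) ℝ) (g : ℝ) (i : Fin m)
    (z : Fin m → EuclideanSpace ℝ (Fin n)) (x : EuclideanSpace ℝ (Fin n)) :
    estimatorField A C N K g i z (Matrix.toEuclideanLin (C i) x) - Matrix.toEuclideanLin A x =
      errorField A C N K g i fun j => z j - x := by
  have hmul : Matrix.toEuclideanLin (K i * C i) =
      Matrix.toEuclideanLin (K i) ∘ₗ Matrix.toEuclideanLin (C i) := Matrix.toLpLin_mul_same _ _ _
  have hav : z i - x - ∑ j, N.averaging i j • (z j - x) = z i - ∑ j, N.averaging i j • z j := by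
    simp only [smul_sub, Finset.sum_sub_distrib, ← Finset.sum_smul, N.sum_averaging, one_smul]
    abel
  rw [errorField, hav, estimatorField, ← N.sum_averaging_smul]
  simp only [map_add, LinearMap.add_apply, hmul, LinearMap.comp_apply, map_sub]
  abel

theorem hasDerivWithinAt_error {A : Matrix (Fin n) (Fin n) ℝ}
    {C : ∀ i, Matrix (Fin (s i)) (Fin n) ℝ} {N : NeighborGraph m}
    {K : ∀ i, Matrix (Fin n) (Fin (s i)) ℝ} {g : ℝ} {x : ℝ → EuclideanSpace ℝ (Fin n)}
    {y : ∀ i, ℝ → EuclideanSpace ℝ (Fin (s i))} {xhat : Fin m → ℝ → EuclideanSpace ℝ (Fin n)}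
    (hx : IsSystemTrajectory A C x y) (hxhat : IsEstimatorTrajectory A C N K g y xhat)
    (i : Fin m) {t : ℝ} (ht : 0 ≤ t) :
    HasDerivWithinAt (fun t => xhat i t - x t)
      (errorField A C N K g i fun j => xhat j t - x t) (Set.Ici 0) t := by
  rw [← estimatorField_sub, ← hx.output i t ht]
  exact (hxhat i t ht).sub (hx.state t ht)

theorem continuous_errorField (A : Matrix (Fin n) (Fin n) ℝ)
    (C : ∀ i, Matrix (Fin (s i)) (Fin n) ℝ) (N : NeighborGraph m)
    (K : ∀ i, Matrix (Fin n) (Fin (s i)) ℝ) (g : ℝ) (i : Fin m) :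
    Continuous (errorField A C N K g i) := by
  have := (Matrix.toEuclideanLin (A + K i * C i)).continuous_of_finiteDimensional
  unfold errorField
  fun_prop

theorem errorField_smul (A : Matrix (Fin n) (Fin n) ℝ)
    (C : ∀ i, Matrix (Fin (s i)) (Fin n) ℝ) (N : NeighborGraph m)
    (K : ∀ i, Matrix (Fin n) (Fin (s i)) ℝ) (g : ℝ) (i : Fin m) (r : ℝ)
    (e : Fin m → EuclideanSpace ℝ (Fin n)) :
    errorField A C N K g i (r • e) = r • errorField A C N K g i e := by
  have h : r • e i - ∑ j, N.averaging i j • r • e j = r • (e i - ∑ j, N.averaging i j • e j) := by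
    rw [smul_sub, Finset.smul_sum]
    simp only [smul_comm r]
  simp only [errorField, Pi.smul_apply]
  rw [h, map_smul, map_smul, smul_sub, smul_comm g r]

/-- The projection is self-adjoint and fixes `v`, so it drops out of the coupling term. -/
theorem inner_errorField_of_mem (A : Matrix (Fin n) (Fin n) ℝ)
    (C : ∀ i, Matrix (Fin (s i)) (Fin n) ℝ) (N : NeighborGraph m)
    (K : ∀ i, Matrix (Fin n) (Fin (s i)) ℝ) (g : ℝ) (i : Fin m)
    (e : Fin m → EuclideanSpace ℝ (Fin n)) {v : EuclideanSpace ℝ (Fin n)}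
    (hv : v ∈ unobservableSpace (C i) A) :
    ⟪v, errorField A C N K g i e⟫_ℝ = ⟪v, Matrix.toEuclideanLin (A + K i * C i) (e i)⟫_ℝ -
      g * ⟪v, e i - ∑ j, N.averaging i j • e j⟫_ℝ := by
  rw [errorField, inner_sub_right, real_inner_smul_right,
    ← Submodule.inner_starProjection_left_eq_right, Submodule.starProjection_eq_self_iff.2 hv]

/-- A strongly connected, jointly observable network: disagreement vanishes on the product of the
unobservable spaces only at the origin. -/
theorem eq_zero_of_disagreement_eq_zero {A : Matrix (Fin n) (Fin n) ℝ}
    {C : ∀ i, Matrix (Fin (s i)) (Fin n) ℝ} {N : NeighborGraph m}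
    (hN : N.IsStronglyConnected) (hobs : IsJointlyObservable A C) {π : Fin m → ℝ}
    (hπ : ∀ i, 0 < π i) {e : Fin m → EuclideanSpace ℝ (Fin n)}
    (he : ∀ i, e i ∈ unobservableSpace (C i) A)
    (h0 : ∑ i, ∑ j, π i * N.averaging i j * ‖e i - e j‖ ^ 2 = 0) : e = 0 := by
  have hnn : ∀ i j, 0 ≤ π i * N.averaging i j * ‖e i - e j‖ ^ 2 := fun i j =>
    mul_nonneg (mul_nonneg (hπ i).le (N.averaging_nonneg i j)) (sq_nonneg _)
  have hadj : ∀ j i, N.Adj j i → e j = e i := by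
    intro j i hji
    have h1 := (Finset.sum_eq_zero_iff_of_nonneg fun i _ => Finset.sum_nonneg fun j _ => hnn i j).1
      h0 i (Finset.mem_univ i)
    have h2 := (Finset.sum_eq_zero_iff_of_nonneg fun j _ => hnn i j).1 h1 j (Finset.mem_univ j)
    have h3 := (mul_pos (hπ i) (N.averaging_pos hji)).ne'
    exact (sub_eq_zero.1 (norm_eq_zero.1 (pow_eq_zero_iff two_ne_zero |>.1
      ((mul_eq_zero.1 h2).resolve_left h3)))).symm
  have hall : ∀ j i, e j = e i := by
    intro j i
    induction hN j i with
    | refl => rfl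
    | tail _ h ih => exact ih.trans (hadj _ _ h)
  funext i
  exact hobs.eq_zero_of_forall_mem fun j => hall j i ▸ he j

/-- For large coupling gains `g`, the weighted energy decays at a rate greater than `lam` on the
product of the unobservable spaces. -/
theorem exists_coupling_gain {A : Matrix (Fin n) (Fin n) ℝ}
    {C : ∀ i, Matrix (Fin (s i)) (Fin n) ℝ} {N : NeighborGraph m}
    (hN : N.IsStronglyConnected) (hobs : IsJointlyObservable A C)
    (K : ∀ i, Matrix (Fin n) (Fin (s i)) ℝ) {π : Fin m → ℝ}
    (hπ : ∀ i, 0 < π i) (hfix : ∀ j, ∑ i, π i * N.averaging i j = π j) (lam : ℝ) :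
    ∃ gstar : ℝ, ∀ g, gstar ≤ g → ∀ e : Fin m → EuclideanSpace ℝ (Fin n),
      (∀ i, e i ∈ unobservableSpace (C i) A) → e ≠ 0 →
      ∑ i, π i * (2 * ⟪e i, errorField A C N K g i e⟫_ℝ) + 2 * lam * ∑ i, π i * ‖e i‖ ^ 2 < 0 := by
  have hB : ∀ i, Continuous (Matrix.toEuclideanLin (A + K i * C i)) := fun i =>
    (Matrix.toEuclideanLin (A + K i * C i)).continuous_of_finiteDimensional
  -- Finsler's multiplier is the coupling gain: `f` collects the terms free of `g`, and `h` is the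
  -- disagreement.
  obtain ⟨gstar, hg⟩ := exists_forall_add_mul_pos_of_homogeneous
    (Submodule.pi Set.univ fun i => unobservableSpace (C i) A)
    (f := fun e => -(∑ i, π i * (2 * ⟪e i, Matrix.toEuclideanLin (A + K i * C i) (e i)⟫_ℝ) +
      2 * lam * ∑ i, π i * ‖e i‖ ^ 2))
    (h := fun e => ∑ i, ∑ j, π i * N.averaging i j * ‖e i - e j‖ ^ 2)
    (by fun_prop) (by fun_prop)
    (fun r e => by
      simp only [Pi.smul_apply, map_smul, real_inner_smul_left, real_inner_smul_right, norm_smul,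
        mul_pow, Real.norm_eq_abs, sq_abs, mul_neg, mul_add, Finset.mul_sum]
      congr 2 <;> exact Finset.sum_congr rfl fun i _ => by ring)
    (fun r e => by
      simp only [Pi.smul_apply, ← smul_sub, norm_smul, mul_pow, Real.norm_eq_abs, sq_abs,
        Finset.mul_sum]
      exact Finset.sum_congr rfl fun i _ => Finset.sum_congr rfl fun j _ => by ring)
    (fun e _ => Finset.sum_nonneg fun i _ => Finset.sum_nonneg fun j _ =>
      mul_nonneg (mul_nonneg (hπ i).le (N.averaging_nonneg i j)) (sq_nonneg _))
    (fun e he he0 h0 => absurd (eq_zero_of_disagreement_eq_zero hN hobs hπ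
      (fun i => he i (Set.mem_univ i)) h0) he0)
  refine ⟨gstar, fun g hgg e he he0 => ?_⟩
  have h1 := hg g hgg e (fun i _ => he i) he0
  have h2 := two_mul_sum_inner_sub_average N.sum_averaging hfix e
  have h3 : ∑ i, π i * (2 * ⟪e i, errorField A C N K g i e⟫_ℝ) =
      ∑ i, π i * (2 * ⟪e i, Matrix.toEuclideanLin (A + K i * C i) (e i)⟫_ℝ) -
        g * (2 * ∑ i, π i * ⟪e i, e i - ∑ j, N.averaging i j • e j⟫_ℝ) := by
    simp only [Finset.mul_sum, ← Finset.sum_sub_distrib]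
    refine Finset.sum_congr rfl fun i _ => ?_
    rw [inner_errorField_of_mem A C N K g i e (he i)]
    ring
  rw [h3, h2]
  linarith

/-- A quadratically homogeneous Lyapunov function yields a uniform exponential estimate. -/
theorem exists_norm_le_exp_of_lyapunov {E : Type*} [NormedAddCommGroup E] [NormedSpace ℝ E]
    [FiniteDimensional ℝ E] {L : E → ℝ} (hL : Continuous L)
    (hL2 : ∀ (r : ℝ) x, L (r • x) = r ^ 2 * L x) (hpos : ∀ x, x ≠ 0 → 0 < L x) (a : ℝ) :
    ∃ c : ℝ, 0 ≤ c ∧ ∀ e : ℝ → E, (∀ t, 0 ≤ t → L (e t) ≤ Real.exp (-(2 * a) * t) * L (e 0)) →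
      ∀ t, 0 ≤ t → ‖e t‖ ≤ c * Real.exp (-a * t) * ‖e 0‖ := by
  have hn2 : ∀ (r : ℝ) (x : E), ‖r • x‖ ^ 2 = r ^ 2 * ‖x‖ ^ 2 := fun r x => by
    rw [norm_smul, mul_pow, Real.norm_eq_abs, sq_abs]
  have hL0 : L 0 = 0 := by simpa using hL2 0 0
  -- Two uses of Finsler's lemma make `L` comparable to `‖x‖²` from both sides.
  obtain ⟨M₁, h1⟩ := exists_forall_add_mul_pos_of_homogeneous (⊤ : Submodule ℝ E)
    (f := fun x => -‖x‖ ^ 2) (h := L) (by fun_prop) hL (fun r x => by rw [hn2]; ring) hL2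
    (fun x _ => by
      rcases eq_or_ne x 0 with rfl | hx
      · exact hL0.ge
      · exact (hpos x hx).le)
    (fun x _ hx h0 => absurd h0 (hpos x hx).ne')
  obtain ⟨M₂, h2⟩ := exists_forall_add_mul_pos_of_homogeneous (⊤ : Submodule ℝ E)
    (f := fun x => -L x) (h := fun x => ‖x‖ ^ 2) (by fun_prop) (by fun_prop)
    (fun r x => by rw [hL2]; ring) hn2 (fun x _ => sq_nonneg _)
    (fun x _ hx h0 => absurd h0 (pow_ne_zero 2 (norm_ne_zero_iff.2 hx)))
  have hlow : ∀ x, ‖x‖ ^ 2 ≤ max M₁ 0 * L x := by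
    intro x
    rcases eq_or_ne x 0 with rfl | hx
    · simp [hL0]
    · have := h1 _ (le_max_left M₁ 0) x trivial hx
      linarith
  have hupp : ∀ x, L x ≤ max M₂ 0 * ‖x‖ ^ 2 := by
    intro x
    rcases eq_or_ne x 0 with rfl | hx
    · simp [hL0]
    · have := h2 _ (le_max_left M₂ 0) x trivial hx
      linarith
  refine ⟨Real.sqrt (max M₁ 0 * max M₂ 0), Real.sqrt_nonneg _, fun e he t ht => ?_⟩
  refine le_of_sq_le_sq ?_ (by positivity)
  have hexp : Real.exp (-a * t) ^ 2 = Real.exp (-(2 * a) * t) := by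
    rw [← Real.exp_nat_mul]; congr 1; push_cast; ring
  rw [mul_pow, mul_pow, Real.sq_sqrt (by positivity), hexp]
  calc ‖e t‖ ^ 2 ≤ max M₁ 0 * L (e t) := hlow _
    _ ≤ max M₁ 0 * (Real.exp (-(2 * a) * t) * (max M₂ 0 * ‖e 0‖ ^ 2)) := by
        gcongr
        exact (he t ht).trans (by gcongr; exact hupp _)
    _ = _ := by ring

end ErrorDynamics

/-! ### The main theorem -/

theorem theorem1 {m n : ℕ} {s : Fin m → ℕ} (A : Matrix (Fin n) (Fin n) ℝ)
    (C : ∀ i, Matrix (Fin (s i)) (Fin n) ℝ) (N : NeighborGraph m)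
    (lam : ℝ) (hlam : 0 < lam)
    (hN : N.IsStronglyConnected) (hobs : IsJointlyObservable A C) :
    ∃ K : ∀ i, Matrix (Fin n) (Fin (s i)) ℝ, ∃ gstar : ℝ, ∀ g : ℝ, gstar ≤ g →
      ∃ c : ℝ, ∀ (x : ℝ → EuclideanSpace ℝ (Fin n))
        (y : ∀ i, ℝ → EuclideanSpace ℝ (Fin (s i)))
        (xhat : Fin m → ℝ → EuclideanSpace ℝ (Fin n)),
        IsSystemTrajectory A C x y → IsEstimatorTrajectory A C N K g y xhat →
          ∀ i t, 0 ≤ t →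
            ‖xhat i t - x t‖ ≤ c * Real.exp (-lam * t) * ∑ j, ‖xhat j 0 - x 0‖ := by
  rcases isEmpty_or_nonempty (Fin m) with hm | hm
  · exact ⟨fun i => hm.elim i, 0, fun _ _ => ⟨0, fun _ _ _ _ _ i => hm.elim i⟩⟩
  -- The extra `1` in the local rate yields the surplus `-2 M Q` that later absorbs the `M Q` in
  -- `hdiss`.
  choose K W hsymm hnonneg hker horth hdec using fun i => exists_observer_gain A (C i) (lam + 1)
  obtain ⟨π, hπ, hfix⟩ := exists_pos_left_fixed_of_stochastic N.averaging_nonneg N.sum_averaging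
    fun i j => (hN i j).lift id fun _ _ h => N.averaging_pos h
  obtain ⟨gstar, hgstar⟩ := exists_coupling_gain hN hobs K hπ hfix lam
  refine ⟨K, gstar, fun g hg => ?_⟩
  set P := fun i => (unobservableSpace (C i) A).starProjection with hP
  set Z := errorField A C N K g with hZ
  have hZc : ∀ i, Continuous (Z i) := continuous_errorField A C N K g
  set Y : (Fin m → EuclideanSpace ℝ (Fin n)) → ℝ := fun e => ∑ i, π i * ‖P i (e i)‖ ^ 2 with hY
  set Y' : (Fin m → EuclideanSpace ℝ (Fin n)) → ℝ := fun e =>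
    ∑ i, π i * (2 * ⟪P i (e i), P i (Z i e)⟫_ℝ) with hY'
  set Q : (Fin m → EuclideanSpace ℝ (Fin n)) → ℝ := fun e => ∑ i, ⟪W i (e i), e i⟫_ℝ with hQ
  set Q' : (Fin m → EuclideanSpace ℝ (Fin n)) → ℝ := fun e =>
    ∑ i, 2 * ⟪W i (e i), Z i e⟫_ℝ with hQ'
  have hYc : Continuous Y := by fun_prop
  have hQc : Continuous Q := by fun_prop
  have hY2 : ∀ (r : ℝ) e, Y (r • e) = r ^ 2 * Y e := fun r e => by
    simp only [hY, Pi.smul_apply, map_smul, norm_smul, mul_pow, Real.norm_eq_abs, sq_abs,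
      Finset.mul_sum]
    exact Finset.sum_congr rfl fun i _ => by ring
  have hY'2 : ∀ (r : ℝ) e, Y' (r • e) = r ^ 2 * Y' e := fun r e => by
    simp only [hY', hZ, errorField_smul, Pi.smul_apply, map_smul, real_inner_smul_left,
      real_inner_smul_right, Finset.mul_sum]
    exact Finset.sum_congr rfl fun i _ => by ring
  have hQ2 : ∀ (r : ℝ) e, Q (r • e) = r ^ 2 * Q e := fun r e => by
    simp only [hQ, Pi.smul_apply, map_smul, real_inner_smul_left, real_inner_smul_right,
      Finset.mul_sum]
    exact Finset.sum_congr rfl fun i _ => by ring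
  have hQnn : ∀ e, 0 ≤ Q e := fun e => Finset.sum_nonneg fun i _ => hnonneg i (e i)
  have hQ0 : ∀ e, Q e = 0 → ∀ i, e i ∈ unobservableSpace (C i) A := fun e he i =>
    hker i _ ((Finset.sum_eq_zero_iff_of_nonneg fun i _ => hnonneg i (e i)).1 he i
      (Finset.mem_univ i))
  have hYmem : ∀ e : Fin m → EuclideanSpace ℝ (Fin n),
      (∀ i, e i ∈ unobservableSpace (C i) A) → Y e = ∑ i, π i * ‖e i‖ ^ 2 := fun e he =>
    Finset.sum_congr rfl fun i _ => by
      simp only [hP, Submodule.starProjection_eq_self_iff.2 (he i)]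
  have hY'mem : ∀ e : Fin m → EuclideanSpace ℝ (Fin n),
      (∀ i, e i ∈ unobservableSpace (C i) A) → Y' e = ∑ i, π i * (2 * ⟪e i, Z i e⟫_ℝ) :=
    fun e he => Finset.sum_congr rfl fun i _ => by
      simp only [hP]
      rw [← Submodule.inner_starProjection_left_eq_right,
        Submodule.starProjection_eq_self_iff.2 (he i),
        Submodule.starProjection_eq_self_iff.2 (he i)]
  have hQ'le : ∀ e, Q' e ≤ -(2 * (lam + 1)) * Q e := by
    intro e
    simp only [hQ, hQ', Finset.mul_sum]
    refine Finset.sum_le_sum fun i _ => ?_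
    have h1 : ⟪W i (e i), Z i e⟫_ℝ = ⟪W i (e i), Matrix.toEuclideanLin (A + K i * C i) (e i)⟫_ℝ := by
      rw [hZ, errorField, inner_sub_right, real_inner_smul_right,
        horth i _ _ (Submodule.starProjection_apply_mem _ _), mul_zero, sub_zero]
    have := hdec i (e i)
    rw [h1]
    linarith
  -- `Q` vanishes only on the product of the unobservable spaces, where the choice of `g` makes `f`
  -- positive away from `0`.
  obtain ⟨M₀, hM₀⟩ := exists_forall_add_mul_pos_of_homogeneous
    (⊤ : Submodule ℝ (Fin m → EuclideanSpace ℝ (Fin n)))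
    (f := fun e => -(Y' e + 2 * lam * Y e)) (h := Q) (by fun_prop) hQc
    (fun r e => by rw [hY2, hY'2]; ring) hQ2 (fun e _ => hQnn e)
    (fun e _ he0 h0 => by
      have := hgstar g hg e (hQ0 e h0) he0
      rw [hYmem e (hQ0 e h0), hY'mem e (hQ0 e h0)]
      linarith)
  set M := max M₀ 1 with hM
  have hM1 : 0 < M := zero_lt_one.trans_le (le_max_right _ _)
  have hYnn : ∀ e, 0 ≤ Y e := fun e =>
    Finset.sum_nonneg fun i _ => mul_nonneg (hπ i).le (sq_nonneg _)
  have hpos : ∀ e, e ≠ 0 → 0 < Y e + M * Q e := by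
    intro e he
    rcases (hQnn e).lt_or_eq with h | h
    · have := mul_pos hM1 h
      have := hYnn e
      linarith
    · rw [← h, mul_zero, add_zero, hYmem e (hQ0 e h.symm)]
      obtain ⟨i, hi⟩ := Function.ne_iff.1 he
      exact Finset.sum_pos' (fun i _ => mul_nonneg (hπ i).le (sq_nonneg _))
        ⟨i, Finset.mem_univ i, mul_pos (hπ i) (pow_pos (norm_pos_iff.2 hi) 2)⟩
  have hdiss : ∀ e, Y' e + M * Q' e ≤ -(2 * lam) * (Y e + M * Q e) := by
    intro e
    have h1 : Y' e + 2 * lam * Y e ≤ M * Q e := by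
      rcases eq_or_ne e 0 with rfl | he
      · have h1 : Y 0 = 0 := by simpa using hY2 0 0
        have h2 : Y' 0 = 0 := by simpa using hY'2 0 0
        have h3 : Q 0 = 0 := by simpa using hQ2 0 0
        simp [h1, h2, h3]
      · have := hM₀ M (le_max_left _ _) e trivial he
        linarith
    have h2 := mul_le_mul_of_nonneg_left (hQ'le e) hM1.le
    have h3 := mul_nonneg hM1.le (hQnn e)
    linarith
  obtain ⟨c, hc0, hc⟩ := exists_norm_le_exp_of_lyapunov (L := fun e => Y e + M * Q e)
    (by fun_prop) (fun r e => by rw [hY2, hQ2]; ring) hpos lam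
  refine ⟨c, fun x y xhat hx hxhat i t ht => ?_⟩
  have hd := fun i t (ht : 0 ≤ t) => hasDerivWithinAt_error hx hxhat i ht
  have hYd : ∀ t, 0 ≤ t → HasDerivWithinAt (fun t => Y fun j => xhat j t - x t)
      (Y' fun j => xhat j t - x t) (Set.Ici 0) t := fun t ht =>
    HasDerivWithinAt.fun_sum fun i _ =>
      (((P i).hasFDerivAt.comp_hasDerivWithinAt t (hd i t ht)).norm_sq).const_mul (π i)
  have hQd : ∀ t, 0 ≤ t → HasDerivWithinAt (fun t => Q fun j => xhat j t - x t)
      (Q' fun j => xhat j t - x t) (Set.Ici 0) t := fun t ht =>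
    HasDerivWithinAt.fun_sum fun i _ =>
      -- Symmetry of `W i` merges the two terms of the product rule.
      (((W i).hasFDerivAt.comp_hasDerivWithinAt t (hd i t ht)).inner ℝ (hd i t ht)).congr_deriv (by
        simp only [Function.comp_apply]
        rw [hsymm i (errorField _ _ _ _ _ _ _), real_inner_comm (W i _) (errorField _ _ _ _ _ _ _)]
        ring)
  have hfin := hc (fun t j => xhat j t - x t) (fun t ht => le_exp_mul_of_hasDerivWithinAt_le
    (fun t ht => (hYd t ht).add ((hQd t ht).const_mul M)) (fun t _ => hdiss _) ht) t ht
  calc ‖xhat i t - x t‖ ≤ ‖fun j => xhat j t - x t‖ :=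
        norm_le_pi_norm (fun j => xhat j t - x t) i
    _ ≤ c * Real.exp (-lam * t) * ‖fun j => xhat j 0 - x 0‖ := hfin
    _ ≤ _ := by
        gcongr
        exact (pi_norm_le_iff_of_nonneg (Finset.sum_nonneg fun _ _ => norm_nonneg _)).2 fun j =>
          Finset.single_le_sum (f := fun j => ‖xhat j 0 - x 0‖) (fun _ _ => norm_nonneg _)
            (Finset.mem_univ j)
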